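/- For $s\in\mathbb R$ and $1\le p<\infty$ let $$H^{s,p}(\mathbb R)=(1-\partial_x^2)^{-s/2}L^p(\mathbb R),\qquad H^s(\mathbb R)=H^{s,2}(\mathbb R),$$ where $(1-\partial_x^2)^{-s/2}$ acts on tempered distributions as the Fourier multiplier that corresponds to $-\partial_x^2\mapsto\xi^2$, that is, with symbol $(1+\xi^2)^{-s/2}$ (for $\widehat f(\xi)=\int f(x)e^{-ix\xi}\,dx$); a function belongs to $H^{s,p}(\mathbb R)$ if it does as a tempered distribution. For every $p\in(1,\infty)$, $$e^{-|x|}\in H^{s,p}(\mathbb R)\quad\text{for all } s\in(0,1+1/p),\qquad\text{but}\qquad e^{-|x|}\notin H^{1+1/p,p}(\mathbb R).$$ In particular, the peakons $u_c(x,t)=c\,e^{-|x-ct|}$, $c>0$, satisfy $u_c(\cdot,t)\notin H^s(\mathbb R)$ for every $t\in\mathbb R$ and every $s\ge 3/2$. -/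

import Mathlib

open MeasureTheory FourierTransform TemperedDistribution
open scoped SchwartzMap ENNReal Real LineDeriv

noncomputable section

/-- The operator `(1 - ∂ₓ²)^(r/2)` on tempered distributions on the line, for real `r`.
Mathlib's Fourier transform is `𝓕 f ξ = ∫ f x * exp (-2πixξ) dx`, so `-∂ₓ²` is multiplication by
`(2πξ)²` on the Fourier side and `(1 - ∂ₓ²)^(r/2)` is the Fourier multiplier with symbol
`(1 + (2πξ)²)^(r/2)`. -/
def besselOp (r : ℝ) : 𝓢'(ℝ, ℂ) →L[ℂ] 𝓢'(ℝ, ℂ) :=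
  fourierMultiplierCLM ℂ (fun ξ : ℝ ↦ (((1 + (2 * π * ξ) ^ 2) ^ (r / 2) : ℝ) : ℂ))

/-- The symbols of the operators `besselOp r` are smooth and of temperate growth, so that
Mathlib's multiplier operators are not the junk operator here. -/
theorem besselSymbol_hasTemperateGrowth (r : ℝ) :
    (fun ξ : ℝ ↦ (((1 + (2 * π * ξ) ^ 2) ^ (r / 2) : ℝ) : ℂ)).HasTemperateGrowth := by
  have h : (fun ξ : ℝ ↦ ((1 + ‖ξ‖ ^ 2) ^ (r / 2) : ℝ)).HasTemperateGrowth :=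
    Function.hasTemperateGrowth_one_add_norm_sq_rpow ℝ (r / 2)
  have h2 : (fun ξ : ℝ ↦ 2 * π * ξ).HasTemperateGrowth := by fun_prop
  have h3 := Function.HasTemperateGrowth.comp Function.Complex.hasTemperateGrowth_ofReal (h.comp h2)
  have e : (fun ξ : ℝ ↦ (((1 + (2 * π * ξ) ^ 2) ^ (r / 2) : ℝ) : ℂ)) =
      Complex.ofReal ∘ ((fun ξ : ℝ ↦ ((1 + ‖ξ‖ ^ 2) ^ (r / 2) : ℝ)) ∘ fun ξ : ℝ ↦ 2 * π * ξ) := by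
    ext ξ
    simp only [Function.comp_apply, Real.norm_eq_abs, sq_abs]
  rw [e]
  exact h3

/-- The Bessel potential space `H^{s,p}(ℝ) = (1 - ∂ₓ²)^(-s/2) L^p(ℝ)`, a space of tempered
distributions: the image of (complex valued) `L^p(ℝ)` under `besselOp (-s)`. -/
def besselSpace (s : ℝ) (p : ℝ≥0∞) [Fact (1 ≤ p)] : Submodule ℂ 𝓢'(ℝ, ℂ) :=
  LinearMap.range ((besselOp (-s)).toLinearMap ∘ₗ
    (Lp.toTemperedDistributionCLM ℂ (volume : Measure ℝ) p).toLinearMap)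

/-- The tempered distribution `u` is the function `f`: `u φ = ∫ φ f` for all Schwartz `φ`,
with convergent integrals. For a given `f` there is at most one such `u`. -/
def IsGivenBy (u : 𝓢'(ℝ, ℂ)) (f : ℝ → ℂ) : Prop :=
  ∀ φ : 𝓢(ℝ, ℂ), Integrable (fun x ↦ φ x * f x) ∧ u φ = ∫ x, φ x * f x

/-- The function `f` belongs to `H^{s,p}(ℝ)`. -/
def MemBesselSpace (f : ℝ → ℂ) (s : ℝ) (p : ℝ≥0∞) [Fact (1 ≤ p)] : Prop :=
  ∃ u ∈ besselSpace s p, IsGivenBy u f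

/-- The function `f` belongs to `H^s(ℝ) = H^{s,2}(ℝ)`. -/
def MemSobolevTwo (f : ℝ → ℂ) (s : ℝ) : Prop := MemBesselSpace f s 2

/-- The single peakon `u_c(x, t) = c e^{-|x - ct|}`. -/
def peakon (c t x : ℝ) : ℝ := c * Real.exp (-|x - c * t|)

end

/-!
The Fourier transform of `e^{-|x|}` is `2 (1 + (2πξ)²)⁻¹`, so that `(1 - ∂ₓ²)^(s/2) e^{-|x|}` is
`2 G_{2-s}` for `s < 2`, where `G_a` is the Bessel kernel, with Fourier transform
`(1 + (2πξ)²)^(-a/2)` (`besselOp_exp_neg_abs_apply`). Hence `e^{-|x|}` lies in `H^{s,p}` if and only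
if `G_{2-s}` lies in `L^p` (`memBesselSpace_exp_neg_abs_iff`).

The Bessel kernel is a Gamma integral of heat kernels, which gives its Fourier transform by Fubini
(`integral_besselKernel_mul_fourier`). Near the origin it has size `|x|^(a-1)` for `a < 1`, and it
decays faster than any power at infinity, so that it lies in `L^p` for `a > 1 - 1/p`
(`memLp_besselKernel`). For `a = 1 - 1/p` a rescaling of the Gamma integral gives
`G_a(x) ≥ G_a(1) |x|^(-1/p)` for `|x| ≤ 1`, and `G_a` is not in `L^p` (`not_memLp_besselKernel`).

For peakons and `p = 2` one argues on the Fourier side: if `u_c(·, t)` were in `H^s`, Plancherel's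
theorem would make `(1 + (2πξ)²)^(s/2-1)` square integrable, which fails for `s ≥ 3/2`
(`not_memSobolevTwo_peakon`).
-/

/-! ### The heat kernel -/

open Set in
theorem integrable_comp_abs_of_integrableOn_Ioi {f : ℝ → ℝ} (hf : IntegrableOn f (Ioi 0)) :
    Integrable fun x ↦ f |x| := by
  have hpos : IntegrableOn (fun x ↦ f |x|) (Ioi 0) :=
    hf.congr_fun (fun x hx ↦ by simp only [abs_of_pos (mem_Ioi.1 hx)]) measurableSet_Ioi
  have hneg : IntegrableOn (fun x ↦ f |x|) (Iic 0) := by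
    rw [← Measure.map_neg_eq_self (volume : Measure ℝ)]
    let m : MeasurableEmbedding fun x : ℝ ↦ -x := (Homeomorph.neg ℝ).measurableEmbedding
    rw [m.integrableOn_map_iff]
    simp_rw [Function.comp_def, abs_neg, neg_preimage, neg_Iic, neg_zero]
    exact (integrableOn_Ici_iff_integrableOn_Ioi (by finiteness)).2 hpos
  rw [← integrableOn_univ, ← Iic_union_Ioi (a := (0 : ℝ))]
  exact hneg.union hpos

/-- The heat kernel on the line, `exp (-x² / 4t) / √(4πt)`, for times `t > 0`. -/
noncomputable def heatKernel (t x : ℝ) : ℝ := Real.exp (-(x ^ 2 / (4 * t))) / √(4 * π * t)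

theorem heatKernel_nonneg (t x : ℝ) : 0 ≤ heatKernel t x := by
  unfold heatKernel; positivity

theorem heatKernel_pos {t : ℝ} (ht : 0 < t) (x : ℝ) : 0 < heatKernel t x := by
  unfold heatKernel; positivity

theorem measurable_heatKernel_uncurry : Measurable fun q : ℝ × ℝ ↦ heatKernel q.1 q.2 := by
  unfold heatKernel; fun_prop

theorem integrable_heatKernel {t : ℝ} (ht : 0 < t) : Integrable (heatKernel t) := by
  have h := (integrable_exp_neg_mul_sq (b := 1 / (4 * t)) (by positivity)).div_const √(4 * π * t)
  refine h.congr (.of_forall fun x ↦ ?_)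
  simp only [heatKernel]
  congr 2
  ring

theorem integral_heatKernel {t : ℝ} (ht : 0 < t) : ∫ x, heatKernel t x = 1 := by
  have h := integral_gaussian (1 / (4 * t))
  have e : ∀ x, heatKernel t x = Real.exp (-(1 / (4 * t)) * x ^ 2) / √(4 * π * t) := fun x ↦ by
    rw [heatKernel]; congr 2; ring
  simp_rw [e]
  rw [integral_div, h, show π / (1 / (4 * t)) = 4 * π * t by field_simp]
  exact div_self (by positivity)

/-- On the Fourier side the heat kernel is the Gaussian `exp (-(2πξ)² t)`. -/
theorem fourier_exp_neg_mul_sq {t : ℝ} (ht : 0 < t) :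
    𝓕 (fun ξ : ℝ ↦ (Real.exp (-((2 * π * ξ) ^ 2 * t)) : ℂ)) = fun x ↦ (heatKernel t x : ℂ) := by
  have hb : 0 < ((4 * π * t : ℝ) : ℂ).re := by rw [Complex.ofReal_re]; positivity
  have e : (fun ξ : ℝ ↦ (Real.exp (-((2 * π * ξ) ^ 2 * t)) : ℂ)) =
      fun ξ : ℝ ↦ Complex.exp (-π * (4 * π * t : ℝ) * ξ ^ 2) := by
    ext ξ; push_cast; congr 1; ring
  rw [e, fourier_gaussian_pi hb]
  ext x
  have h0 : (0 : ℝ) ≤ 4 * π * t := by positivity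
  rw [heatKernel, Real.sqrt_eq_rpow, Complex.ofReal_div, Complex.ofReal_cpow h0, one_div_mul_eq_div]
  congr 1
  · push_cast
    have : (t : ℂ) ≠ 0 := by exact_mod_cast ht.ne'
    have : (π : ℂ) ≠ 0 := by exact_mod_cast Real.pi_ne_zero
    congr 1
    field_simp
  · push_cast; rfl

/-- Self-adjointness of the Fourier transform, for an integrable function against a Schwartz
function. -/
theorem integral_mul_fourier_schwartz {f : ℝ → ℂ} (hf : Integrable f) (ψ : 𝓢(ℝ, ℂ)) :
    ∫ x, f x * 𝓕 ψ x = ∫ ξ, 𝓕 f ξ * ψ ξ := by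
  have := VectorFourier.integral_bilin_fourierIntegral_eq_flip (.mul ℂ ℂ) (L := innerₗ ℝ)
    (μ := volume) (ν := volume)
    Real.continuous_fourierChar continuous_inner hf ψ.integrable
  simpa using! this.symm

theorem integral_heatKernel_mul_fourier {t : ℝ} (ht : 0 < t) (ψ : 𝓢(ℝ, ℂ)) :
    ∫ x, (heatKernel t x : ℂ) * 𝓕 ψ x =
      ∫ ξ, (Real.exp (-((2 * π * ξ) ^ 2 * t)) : ℂ) * ψ ξ := by
  have hint : Integrable (fun ξ : ℝ ↦ (Real.exp (-((2 * π * ξ) ^ 2 * t)) : ℂ)) := by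
    refine Integrable.ofReal ((integrable_exp_neg_mul_sq (b := (2 * π) ^ 2 * t)
      (by positivity)).congr (.of_forall fun x ↦ ?_))
    simp only
    congr 1
    ring
  have h := integral_mul_fourier_schwartz hint (𝓕 ψ)
  rw [fourier_exp_neg_mul_sq ht] at h
  rw [← h]
  -- The Gaussian is even, so that it does not see the reflection `𝓕 (𝓕 ψ) = ψ (-·)`.
  rw [← integral_neg_eq_self]
  congr 1
  ext x
  have : 𝓕 (𝓕 ψ) (-x) = ψ x := by
    have h2 : 𝓕⁻ (𝓕 ψ) = ψ := FourierTransform.fourierInv_fourier_eq ψ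
    rw [← congrArg (· x) h2]
    simp only [SchwartzMap.fourierInv_coe, Real.fourierInv_eq_fourier_neg, SchwartzMap.fourier_coe (𝓕 ψ)]
  rw [this]
  simp

/-! ### The Bessel kernel and its Fourier transform -/

/-- The Bessel kernel `G_a` of order `a > 0` on the line, whose Fourier transform is
`(1 + (2πξ)²)^(-a/2)`, written as a Gamma integral over heat kernels. -/
noncomputable def besselKernel (a x : ℝ) : ℝ :=
  (Real.Gamma (a / 2))⁻¹ *
    ∫ t in Set.Ioi 0, Real.exp (-t) * t ^ (a / 2 - 1) * heatKernel t x

theorem besselKernel_nonneg {a : ℝ} (ha : 0 < a) (x : ℝ) : 0 ≤ besselKernel a x := by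
  refine mul_nonneg (inv_nonneg.2 (Real.Gamma_pos_of_pos (by positivity)).le)
    (setIntegral_nonneg measurableSet_Ioi fun t ht ↦ ?_)
  have := heatKernel_nonneg t x
  have : (0 : ℝ) < t := ht
  positivity

theorem integrable_besselKernel_prod {a : ℝ} (ha : 0 < a) :
    Integrable (fun q : ℝ × ℝ ↦ Real.exp (-q.1) * q.1 ^ (a / 2 - 1) * heatKernel q.1 q.2)
      ((volume.restrict (Set.Ioi 0)).prod volume) := by
  have hmeas := measurable_heatKernel_uncurry
  rw [integrable_prod_iff (by fun_prop)]
  refine ⟨(ae_restrict_mem measurableSet_Ioi).mono fun t ht ↦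
    (integrable_heatKernel ht).const_mul (Real.exp (-t) * t ^ (a / 2 - 1)), ?_⟩
  refine (Real.GammaIntegral_convergent (s := a / 2) (by positivity)).congr
    ((ae_restrict_mem measurableSet_Ioi).mono fun t ht ↦ ?_)
  have h0 : 0 ≤ Real.exp (-t) * t ^ (a / 2 - 1) := by
    have : (0 : ℝ) < t := ht
    positivity
  simp only [Real.norm_of_nonneg (mul_nonneg h0 (heatKernel_nonneg t _))]
  rw [integral_const_mul, integral_heatKernel ht, mul_one]

theorem integrable_besselKernel {a : ℝ} (ha : 0 < a) : Integrable (besselKernel a) :=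
  (integrable_besselKernel_prod ha).integral_prod_right.const_mul _

theorem integral_exp_neg_mul_rpow_mul_exp {a : ℝ} (ha : 0 < a) (ξ : ℝ) :
    ∫ t in Set.Ioi 0, Real.exp (-t) * t ^ (a / 2 - 1) * Real.exp (-((2 * π * ξ) ^ 2 * t)) =
      Real.Gamma (a / 2) * (1 + (2 * π * ξ) ^ 2) ^ (-a / 2) := by
  have hr : 0 < 1 + (2 * π * ξ) ^ 2 := by positivity
  have h := Real.integral_rpow_mul_exp_neg_mul_Ioi (a := a / 2) (by positivity) hr
  rw [neg_div, Real.rpow_neg hr.le, ← Real.inv_rpow hr.le, ← one_div,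
    mul_comm (Real.Gamma _), ← h]
  congr 1
  ext t
  rw [mul_comm (Real.exp (-t)), mul_assoc, ← Real.exp_add]
  congr 2
  ring

/-- The Fourier transform of the Bessel kernel, in weak form. -/
theorem integral_besselKernel_mul_fourier {a : ℝ} (ha : 0 < a) (ψ : 𝓢(ℝ, ℂ)) :
    ∫ x, (besselKernel a x : ℂ) * 𝓕 ψ x =
      ∫ ξ : ℝ, (((1 + (2 * π * ξ) ^ 2) ^ (-a / 2) : ℝ) : ℂ) * ψ ξ := by
  have hmeas := measurable_heatKernel_uncurry
  have hG : (Real.Gamma (a / 2) : ℂ) ≠ 0 := by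
    exact_mod_cast (Real.Gamma_pos_of_pos (by positivity)).ne'
  obtain ⟨C, hC⟩ : ∃ C, ∀ x, ‖𝓕 ψ x‖ ≤ C :=
    ⟨_, fun x ↦ SchwartzMap.norm_le_seminorm ℂ (𝓕 ψ) x⟩
  have hi₁ : Integrable (fun q : ℝ × ℝ ↦
      ((Real.exp (-q.1) * q.1 ^ (a / 2 - 1) * heatKernel q.1 q.2 : ℝ) : ℂ) * 𝓕 ψ q.2)
      ((volume.restrict (Set.Ioi 0)).prod volume) :=
    (integrable_besselKernel_prod ha).ofReal.mul_bdd (c := C)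
      (by have := (𝓕 ψ).continuous; fun_prop) (.of_forall fun q ↦ hC q.2)
  have hi₂ : Integrable (fun q : ℝ × ℝ ↦
      ((Real.exp (-q.1) * q.1 ^ (a / 2 - 1) * Real.exp (-((2 * π * q.2) ^ 2 * q.1)) : ℝ) : ℂ) *
        ψ q.2) ((volume.restrict (Set.Ioi 0)).prod volume) := by
    have h := (Real.GammaIntegral_convergent (s := a / 2) (by positivity)).ofReal (𝕜 := ℂ)
      |>.mul_prod ψ.integrable (ν := volume)
    refine h.mono (by have := ψ.continuous; fun_prop) ?_
    have hq : ∀ᵐ q ∂(volume.restrict (Set.Ioi (0 : ℝ))).prod (volume : Measure ℝ), 0 < q.1 :=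
      Measure.quasiMeasurePreserving_fst.ae (ae_restrict_mem measurableSet_Ioi)
    filter_upwards [hq] with q hq
    rw [Complex.ofReal_mul, norm_mul, norm_mul, norm_mul]
    refine mul_le_mul_of_nonneg_right (mul_le_of_le_one_right (norm_nonneg _) ?_) (norm_nonneg _)
    rw [Complex.norm_real, Real.norm_of_nonneg (Real.exp_nonneg _), Real.exp_le_one_iff]
    have := mul_nonneg (sq_nonneg (2 * π * q.2)) hq.le
    linarith
  calc ∫ x, (besselKernel a x : ℂ) * 𝓕 ψ x
      = (Real.Gamma (a / 2) : ℂ)⁻¹ * ∫ x, ∫ t in Set.Ioi 0,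
          ((Real.exp (-t) * t ^ (a / 2 - 1) * heatKernel t x : ℝ) : ℂ) * 𝓕 ψ x := by
        rw [← integral_const_mul]
        congr 1
        ext x
        rw [integral_mul_const, besselKernel, integral_complex_ofReal]
        push_cast
        ring
    _ = (Real.Gamma (a / 2) : ℂ)⁻¹ * ∫ t in Set.Ioi 0, ∫ x,
          ((Real.exp (-t) * t ^ (a / 2 - 1) * heatKernel t x : ℝ) : ℂ) * 𝓕 ψ x := by
        rw [← integral_integral_swap hi₁]
    _ = (Real.Gamma (a / 2) : ℂ)⁻¹ * ∫ t in Set.Ioi 0, ∫ ξ : ℝ,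
          ((Real.exp (-t) * t ^ (a / 2 - 1) * Real.exp (-((2 * π * ξ) ^ 2 * t)) : ℝ) : ℂ) *
            ψ ξ := by
        congr 1
        refine setIntegral_congr_fun measurableSet_Ioi fun t ht ↦ ?_
        simp only [Complex.ofReal_mul (_ * _), mul_assoc (Complex.ofReal (_ * _))]
        rw [integral_const_mul, integral_const_mul, integral_heatKernel_mul_fourier ht]
    _ = (Real.Gamma (a / 2) : ℂ)⁻¹ * ∫ ξ : ℝ, ∫ t in Set.Ioi 0,
          ((Real.exp (-t) * t ^ (a / 2 - 1) * Real.exp (-((2 * π * ξ) ^ 2 * t)) : ℝ) : ℂ) *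
            ψ ξ := by
        rw [integral_integral_swap hi₂]
    _ = _ := by
        rw [← integral_const_mul]
        congr 1
        ext ξ
        rw [integral_mul_const, integral_complex_ofReal, integral_exp_neg_mul_rpow_mul_exp ha]
        push_cast
        field_simp

/-! ### Size and integrability of the Bessel kernel -/

/-- Raise `y / b ≤ exp (y / b)` to the power `b`. -/
theorem exp_neg_le_rpow {b y : ℝ} (hb : 0 ≤ b) (hy : 0 < y) :
    Real.exp (-y) ≤ b ^ b * y ^ (-b) := by
  rcases hb.eq_or_lt with rfl | hb
  · simp [hy.le]
  · have h1 : (y / b) ^ b ≤ Real.exp y := by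
      have h := Real.rpow_le_rpow (by positivity)
        ((by linarith : y / b ≤ y / b + 1).trans (Real.add_one_le_exp (y / b))) hb.le
      rwa [← Real.exp_mul, div_mul_cancel₀ _ hb.ne'] at h
    rw [Real.div_rpow hy.le hb.le, div_le_iff₀ (by positivity)] at h1
    rw [Real.exp_neg, Real.rpow_neg hy.le, inv_le_iff_one_le_mul₀ (Real.exp_pos y), mul_right_comm,
      ← div_eq_mul_inv, one_le_div (by positivity)]
    linarith

/-- Bounding the Gaussian factor by a power of `x² / 4t` turns the integrand of the Bessel kernel
into a Gamma integrand times a power of `|x|`. -/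
theorem besselKernel_integrand_le {b : ℝ} (a : ℝ) (hb : 0 ≤ b) :
    ∃ C, 0 ≤ C ∧ ∀ x t : ℝ, x ≠ 0 → 0 < t →
      Real.exp (-t) * t ^ (a / 2 - 1) * heatKernel t x ≤
        C * |x| ^ (-2 * b) * (Real.exp (-t) * t ^ (((a - 1) / 2 + b) - 1)) := by
  refine ⟨b ^ b * 4 ^ b / √(4 * π), by positivity, fun x t hx ht ↦ ?_⟩
  have hx' : 0 < |x| := abs_pos.2 hx
  have h := exp_neg_le_rpow hb (y := x ^ 2 / (4 * t)) (by positivity)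
  have e1 : (x ^ 2 / (4 * t)) ^ (-b) = |x| ^ (-2 * b) * (4 ^ b * t ^ b) := by
    rw [← sq_abs, Real.div_rpow (by positivity) (by positivity),
      Real.rpow_neg (by positivity : 0 ≤ 4 * t), div_inv_eq_mul,
      Real.mul_rpow (by norm_num) ht.le, ← Real.rpow_natCast, ← Real.rpow_mul hx'.le]
    congr 2
    push_cast
    ring
  have e2 : t ^ (((a - 1) / 2 + b) - 1) = t ^ (a / 2 - 1) * t ^ b / √t := by
    rw [Real.sqrt_eq_rpow, ← Real.rpow_add ht, ← Real.rpow_sub ht]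
    congr 1
    ring
  rw [e1] at h
  rw [heatKernel, Real.sqrt_mul (by positivity), e2]
  calc _ ≤ Real.exp (-t) * t ^ (a / 2 - 1) *
        (b ^ b * (|x| ^ (-2 * b) * (4 ^ b * t ^ b)) / (√(4 * π) * √t)) := by gcongr
    _ = _ := by field_simp

theorem integrableOn_besselKernel_integrand (a : ℝ) {x : ℝ} (hx : x ≠ 0) :
    IntegrableOn (fun t ↦ Real.exp (-t) * t ^ (a / 2 - 1) * heatKernel t x) (Set.Ioi 0) := by
  have hmeas := measurable_heatKernel_uncurry
  have hb : 0 < (a - 1) / 2 + (|a| + 1) := by linarith [neg_abs_le a, abs_nonneg a]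
  obtain ⟨C, -, hC⟩ := besselKernel_integrand_le a (b := |a| + 1) (by positivity)
  refine ((Real.GammaIntegral_convergent hb).const_mul (C * |x| ^ (-2 * (|a| + 1)))).mono'
    (by fun_prop) ((ae_restrict_mem measurableSet_Ioi).mono fun t ht ↦ ?_)
  have := heatKernel_nonneg t x
  have ht' : (0 : ℝ) < t := ht
  rw [Real.norm_of_nonneg (by positivity)]
  exact hC x t hx ht

/-- For `a < 1`, values of `b` close to `(1 - a) / 2` bound `G_a` near `0` by almost its true size
`|x|^(a - 1)`; large `b` give decay at infinity. -/
theorem besselKernel_le {a b : ℝ} (ha : 0 < a) (hb : 0 ≤ b) (hab : (1 - a) / 2 < b) :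
    ∃ C, ∀ x ≠ 0, besselKernel a x ≤ C * |x| ^ (-2 * b) := by
  obtain ⟨C, -, hC⟩ := besselKernel_integrand_le a hb
  have hG := Real.Gamma_pos_of_pos (s := a / 2) (by positivity)
  refine ⟨(Real.Gamma (a / 2))⁻¹ * C *
    ∫ t in Set.Ioi 0, Real.exp (-t) * t ^ (((a - 1) / 2 + b) - 1), fun x hx ↦ ?_⟩
  have h := setIntegral_mono_on (integrableOn_besselKernel_integrand a hx)
    ((Real.GammaIntegral_convergent (s := (a - 1) / 2 + b) (by linarith)).const_mul
      (C * |x| ^ (-2 * b))) measurableSet_Ioi fun t ht ↦ hC x t hx ht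
  rw [integral_const_mul] at h
  calc besselKernel a x ≤ (Real.Gamma (a / 2))⁻¹ * _ :=
        mul_le_mul_of_nonneg_left h (inv_nonneg.2 hG.le)
    _ = _ := by ring

theorem besselKernel_pos {a x : ℝ} (ha : 0 < a) (hx : x ≠ 0) : 0 < besselKernel a x := by
  refine mul_pos (inv_pos.2 (Real.Gamma_pos_of_pos (by positivity))) ?_
  have hpos : ∀ t ∈ Set.Ioi (0 : ℝ), 0 < Real.exp (-t) * t ^ (a / 2 - 1) * heatKernel t x :=
    fun t ht ↦ by
      have := heatKernel_pos ht x
      have : (0 : ℝ) < t := ht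
      positivity
  rw [setIntegral_pos_iff_support_of_nonneg_ae
    ((ae_restrict_mem measurableSet_Ioi).mono fun t ht ↦ (hpos t ht).le)
    (integrableOn_besselKernel_integrand a hx)]
  rw [Set.inter_eq_right.2 fun t ht ↦ Function.mem_support.2 (hpos t ht).ne']
  simp

/-- The substitution `t = x² τ` shows that `G_a` has a singularity of order at least `1 - a`. -/
theorem rpow_mul_besselKernel_one_le {a x : ℝ} (ha : 0 < a) (hx : 0 < x) (hx1 : x ≤ 1) :
    x ^ (a - 1) * besselKernel a 1 ≤ besselKernel a x := by
  have hG := Real.Gamma_pos_of_pos (s := a / 2) (by positivity)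
  have hx2 : 0 < x ^ 2 := by positivity
  have hsub := integral_comp_mul_left_Ioi
    (fun t ↦ Real.exp (-t) * t ^ (a / 2 - 1) * heatKernel t x) 0 hx2
  rw [mul_zero, smul_eq_mul, ← div_eq_inv_mul, eq_div_iff hx2.ne'] at hsub
  have hint : IntegrableOn (fun t ↦ Real.exp (-(x ^ 2 * t)) * (x ^ 2 * t) ^ (a / 2 - 1) *
      heatKernel (x ^ 2 * t) x) (Set.Ioi 0) := by
    have := integrableOn_besselKernel_integrand a hx.ne'
    rw [← mul_zero (x ^ 2)] at this
    exact (integrableOn_Ioi_comp_mul_left_iff _ _ hx2).2 this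
  have hmono : ∫ t in Set.Ioi 0,
        x ^ (a - 3) * (Real.exp (-t) * t ^ (a / 2 - 1) * heatKernel t 1) ≤
      ∫ t in Set.Ioi 0, Real.exp (-(x ^ 2 * t)) * (x ^ 2 * t) ^ (a / 2 - 1) *
        heatKernel (x ^ 2 * t) x := by
    refine setIntegral_mono_on
      ((integrableOn_besselKernel_integrand a one_ne_zero).const_mul _) hint measurableSet_Ioi
      fun t ht ↦ ?_
    have ht : 0 < t := ht
    have e1 : (x ^ 2 * t) ^ (a / 2 - 1) = x ^ (a - 2) * t ^ (a / 2 - 1) := by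
      rw [Real.mul_rpow hx2.le ht.le, ← Real.rpow_natCast, ← Real.rpow_mul hx.le]
      congr 2
      push_cast
      ring
    have e2 : heatKernel (x ^ 2 * t) x = heatKernel t 1 / x := by
      rw [heatKernel, heatKernel, show 4 * π * (x ^ 2 * t) = 4 * π * t * x ^ 2 by ring,
        Real.sqrt_mul (by positivity), Real.sqrt_sq hx.le, ← div_div]
      congr 4
      field_simp
    have e3 : x ^ (a - 3) = x ^ (a - 2) / x := by
      rw [← Real.rpow_sub_one hx.ne']
      congr 1
      ring
    have h4 : Real.exp (-t) ≤ Real.exp (-(x ^ 2 * t)) := by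
      rw [Real.exp_le_exp, neg_le_neg_iff]
      exact mul_le_of_le_one_left ht.le (pow_le_one₀ hx.le hx1)
    have := heatKernel_nonneg t 1
    rw [e1, e2, e3]
    calc _ = Real.exp (-t) * (x ^ (a - 2) * t ^ (a / 2 - 1)) * (heatKernel t 1 / x) := by ring
      _ ≤ _ := by gcongr
  rw [integral_const_mul] at hmono
  have e3 : x ^ (a - 1) = x ^ (a - 3) * x ^ 2 := by
    rw [← Real.rpow_natCast, ← Real.rpow_add hx]
    congr 1
    push_cast
    ring
  have h := mul_le_mul_of_nonneg_right hmono hx2.le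
  rw [hsub] at h
  rw [besselKernel, besselKernel, e3]
  calc _ = (Real.Gamma (a / 2))⁻¹ * _ := by ring
    _ ≤ _ := mul_le_mul_of_nonneg_left h (inv_nonneg.2 hG.le)

/-- `G_a` behaves like `|x|^(a - 1)` at `0` and decays rapidly at infinity. -/
theorem memLp_besselKernel {a p : ℝ} (ha : 0 < a) (hp : 1 ≤ p) (hap : 1 - 1 / p < a) :
    MemLp (besselKernel a) (ENNReal.ofReal p) := by
  have hp0 : 0 < p := by linarith
  have hmeas : AEStronglyMeasurable (besselKernel a) := (integrable_besselKernel ha).1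
  have hmeas' : AEStronglyMeasurable fun x ↦ ‖besselKernel a x‖ ^ p :=
    (hmeas.norm.aemeasurable.pow_const p).aestronglyMeasurable
  -- The bound with exponent `b` is `p`-integrable near `0`, the one with exponent `1` near infinity.
  obtain ⟨b, hb₁, hb₂⟩ := exists_between
    (max_lt (by positivity : 0 < 1 / p / 2) (by linarith : (1 - a) / 2 < 1 / p / 2))
  obtain ⟨hb, hab⟩ := max_lt_iff.1 hb₁
  obtain ⟨C₀, hC₀⟩ := besselKernel_le ha hb.le hab
  obtain ⟨C₁, hC₁⟩ := besselKernel_le ha zero_le_one (by linarith)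
  have hbp : -1 < -2 * b * p := by
    rw [div_div, lt_div_iff₀ (by positivity)] at hb₂
    linarith
  rw [← integrable_norm_rpow_iff hmeas (by simpa using hp0) ENNReal.ofReal_ne_top,
    ENNReal.toReal_ofReal hp0.le]
  have key : ∀ {C c x : ℝ}, 0 < x → besselKernel a x ≤ C * |x| ^ c →
      ‖‖besselKernel a x‖ ^ p‖ ≤ C ^ p * x ^ (c * p) := fun {C c x} hx h ↦ by
    have h0 := besselKernel_nonneg ha x
    rw [abs_of_pos hx] at h
    have hC : 0 ≤ C := nonneg_of_mul_nonneg_left (h0.trans h) (by positivity)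
    rw [Real.norm_of_nonneg h0, Real.norm_of_nonneg (by positivity), Real.rpow_mul hx.le,
      ← Real.mul_rpow hC (by positivity)]
    exact Real.rpow_le_rpow h0 h hp0.le
  have h₀ : IntegrableOn (fun x ↦ ‖besselKernel a x‖ ^ p) (Set.Ioc 0 1) := by
    have h : IntegrableOn (fun x : ℝ ↦ x ^ (-2 * b * p)) (Set.Ioc 0 1) :=
      (intervalIntegrable_iff_integrableOn_Ioc_of_le zero_le_one).1
        (intervalIntegral.intervalIntegrable_rpow' hbp)
    refine (h.const_mul (C₀ ^ p)).mono' hmeas'.restrict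
      ((ae_restrict_mem measurableSet_Ioc).mono fun x hx ↦ key hx.1 (hC₀ x hx.1.ne'))
  have h₁ : IntegrableOn (fun x ↦ ‖besselKernel a x‖ ^ p) (Set.Ioi 1) := by
    have h := integrableOn_Ioi_rpow_of_lt (a := -2 * 1 * p) (by linarith) zero_lt_one
    refine (h.const_mul (C₁ ^ p)).mono' hmeas'.restrict
      ((ae_restrict_mem measurableSet_Ioi).mono fun x hx ↦ ?_)
    have hx : 0 < x := zero_lt_one.trans hx
    exact key hx (hC₁ x hx.ne')
  have h := h₀.union h₁
  rw [Set.Ioc_union_Ioi_eq_Ioi zero_le_one] at h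
  refine (integrable_comp_abs_of_integrableOn_Ioi h).congr (.of_forall fun x ↦ ?_)
  simp only [besselKernel, heatKernel, sq_abs]

/-- At the critical order, `G_a ^ p` is bounded below by a multiple of `1 / x` on `(0, 1)`. -/
theorem not_memLp_besselKernel {p : ℝ} (hp : 1 < p) :
    ¬ MemLp (besselKernel (1 - 1 / p)) (ENNReal.ofReal p) := by
  intro h
  have hp0 : 0 < p := by linarith
  have ha : 0 < 1 - 1 / p := by
    rw [sub_pos, div_lt_one hp0]
    exact hp
  have hc := besselKernel_pos ha one_ne_zero
  rw [← integrable_norm_rpow_iff h.1 (by simpa using hp0) ENNReal.ofReal_ne_top,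
    ENNReal.toReal_ofReal hp0.le] at h
  have hinv : IntegrableOn (fun x : ℝ ↦ x ^ (-1 : ℝ)) (Set.Ioo 0 1) := by
    refine (h.integrableOn (s := Set.Ioo 0 1)).const_mul ((besselKernel (1 - 1 / p) 1) ^ p)⁻¹
      |>.mono' (by fun_prop) ((ae_restrict_mem measurableSet_Ioo).mono fun x hx ↦ ?_)
    have hx0 : 0 < x := hx.1
    have h1 := Real.rpow_le_rpow (by positivity)
      (rpow_mul_besselKernel_one_le ha hx0 hx.2.le) hp0.le
    rw [Real.mul_rpow (by positivity) hc.le, ← Real.rpow_mul hx0.le,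
      show (1 - 1 / p - 1) * p = -1 by field_simp; ring] at h1
    rw [Real.norm_of_nonneg (by positivity), Real.norm_of_nonneg (besselKernel_nonneg ha x),
      ← div_eq_inv_mul, le_div_iff₀ (by positivity)]
    exact h1
  rw [intervalIntegral.integrableOn_Ioo_rpow_iff zero_lt_one] at hinv
  exact lt_irrefl _ hinv

/-! ### The Fourier transform of a peakon -/

theorem integrable_peakon (c t : ℝ) : Integrable (peakon c t) := by
  have h := integrable_comp_abs_of_integrableOn_Ioi (integrableOn_exp_neg_Ioi 0)
  exact (h.comp_sub_right (c * t)).const_mul c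

theorem integral_fourierChar_mul_exp_neg_abs (ξ : ℝ) :
    ∫ x : ℝ, Complex.exp (-(2 * π * ξ * Complex.I) * x) * (Real.exp (-|x|) : ℂ) =
      2 / (1 + (2 * π * ξ) ^ 2) := by
  set w : ℂ := 2 * π * ξ * Complex.I with hw
  have hre : w.re = 0 := by simp [hw]
  have hint : Integrable fun x : ℝ ↦ Complex.exp (-w * x) * (Real.exp (-|x|) : ℂ) := by
    refine (integrable_comp_abs_of_integrableOn_Ioi
      (integrableOn_exp_neg_Ioi 0)).ofReal.bdd_mul (c := 1) (by fun_prop) (.of_forall fun x ↦ ?_)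
    rw [Complex.norm_exp]
    simp [hre]
  have h₁ : ∫ x in Set.Iic (0 : ℝ), Complex.exp (-w * x) * (Real.exp (-|x|) : ℂ) = 1 / (1 - w) := by
    rw [setIntegral_congr_fun (g := fun x : ℝ ↦ Complex.exp ((1 - w) * x)) measurableSet_Iic
      fun x hx ↦ by
        simp only [abs_of_nonpos (Set.mem_Iic.1 hx), neg_neg, Complex.ofReal_exp, ← Complex.exp_add]
        ring_nf, integral_exp_mul_complex_Iic (by simp [hre])]
    simp
  have h₂ : ∫ x in Set.Ioi (0 : ℝ), Complex.exp (-w * x) * (Real.exp (-|x|) : ℂ) = 1 / (1 + w) := by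
    rw [setIntegral_congr_fun (g := fun x : ℝ ↦ Complex.exp ((-1 - w) * x)) measurableSet_Ioi
      fun x hx ↦ by
        simp only [abs_of_pos (Set.mem_Ioi.1 hx), Complex.ofReal_exp, ← Complex.exp_add]
        push_cast
        ring_nf, integral_exp_mul_complex_Ioi (by simp [hre])]
    rw [show -1 - w = -(1 + w) by ring, Complex.ofReal_zero, mul_zero, Complex.exp_zero,
      neg_div_neg_eq]
  rw [← intervalIntegral.integral_Iic_add_Ioi hint.integrableOn hint.integrableOn, h₁, h₂]
  have n₁ : 1 - w ≠ 0 := fun h ↦ by simpa [hre] using congrArg Complex.re h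
  have n₂ : 1 + w ≠ 0 := fun h ↦ by simpa [hre] using congrArg Complex.re h
  have e : (1 : ℂ) + (2 * π * ξ) ^ 2 = (1 - w) * (1 + w) := by
    rw [hw]
    linear_combination (2 * π * ξ : ℂ) ^ 2 * Complex.I_sq
  rw [e]
  field_simp
  ring

theorem fourier_peakon (c t ξ : ℝ) :
    𝓕 (fun x ↦ (peakon c t x : ℂ)) ξ =
      c * Complex.exp ((-(2 * π * (c * t) * ξ) : ℝ) * Complex.I) *
        (2 * (1 + (2 * π * ξ) ^ 2) ^ (-1 : ℝ) : ℝ) := by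
  rw [Real.fourier_real_eq_integral_exp_smul, ← integral_add_right_eq_self _ (c * t)]
  have e : ∀ x : ℝ, Complex.exp (↑(-2 * π * (x + c * t) * ξ) * Complex.I) •
      (peakon c t (x + c * t) : ℂ) =
      c * Complex.exp ((-(2 * π * (c * t) * ξ) : ℝ) * Complex.I) *
        (Complex.exp (-(2 * π * ξ * Complex.I) * x) * (Real.exp (-|x|) : ℂ)) := fun x ↦ by
    rw [show (((-2 * π * (x + c * t) * ξ : ℝ) : ℂ) * Complex.I) =
        (-(2 * π * (c * t) * ξ) : ℝ) * Complex.I + -(2 * π * ξ * Complex.I) * x by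
          push_cast; ring,
      Complex.exp_add, peakon, add_sub_cancel_right, smul_eq_mul, Complex.ofReal_mul]
    ring
  simp_rw [e]
  rw [integral_const_mul, integral_fourierChar_mul_exp_neg_abs, Real.rpow_neg_one]
  push_cast
  rw [← div_eq_mul_inv]

/-! ### Bessel potential operators and spaces -/

/-- On the Fourier side, `besselOp r` multiplies an integrable function by its symbol. -/
theorem besselOp_apply_of_isGivenBy {u : 𝓢'(ℝ, ℂ)} {f : ℝ → ℂ} (hf : Integrable f)
    (hu : IsGivenBy u f) (r : ℝ) (φ : 𝓢(ℝ, ℂ)) :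
    besselOp r u φ =
      ∫ ξ : ℝ, 𝓕 f ξ * ((((1 + (2 * π * ξ) ^ 2) ^ (r / 2) : ℝ) : ℂ) * 𝓕⁻ φ ξ) := by
  rw [besselOp, fourierMultiplierCLM_apply_apply, (hu _).2]
  simp_rw [mul_comm _ (f _)]
  rw [integral_mul_fourier_schwartz hf]
  simp_rw [SchwartzMap.smulLeftCLM_apply_apply (besselSymbol_hasTemperateGrowth r), smul_eq_mul]

/-- `besselOp s` and `besselOp (-s)` are inverse to each other. -/
theorem mem_besselSpace_iff {u : 𝓢'(ℝ, ℂ)} {s : ℝ} {p : ℝ≥0∞} [Fact (1 ≤ p)] :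
    u ∈ besselSpace s p ↔
      ∃ g : Lp ℂ p (volume : Measure ℝ), besselOp s u = Lp.toTemperedDistribution g := by
  have hcomp : ∀ (r r' : ℝ), r + r' = 0 → ∀ v, besselOp r' (besselOp r v) = v := fun r r' h v ↦ by
    rw [besselOp, besselOp, fourierMultiplierCLM_fourierMultiplierCLM_apply
      (besselSymbol_hasTemperateGrowth r) (besselSymbol_hasTemperateGrowth r')]
    have : ((fun ξ : ℝ ↦ (((1 + (2 * π * ξ) ^ 2) ^ (r / 2) : ℝ) : ℂ)) *
        fun ξ : ℝ ↦ (((1 + (2 * π * ξ) ^ 2) ^ (r' / 2) : ℝ) : ℂ)) = fun _ ↦ 1 := by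
      ext ξ
      rw [Pi.mul_apply, ← Complex.ofReal_mul, ← Real.rpow_add (by positivity), ← add_div, h]
      simp
    rw [this, fourierMultiplierCLM_const]
    simp
  constructor
  · rintro ⟨g, rfl⟩
    exact ⟨g, hcomp (-s) s (by ring) _⟩
  · rintro ⟨g, hg⟩
    refine ⟨g, ?_⟩
    change besselOp (-s) (Lp.toTemperedDistribution g) = u
    rw [← hg, hcomp s (-s) (by ring)]

/-- A locally integrable function is determined by the tempered distribution it defines. -/
theorem ae_eq_of_integral_schwartz_mul_eq {f g : ℝ → ℂ} (hf : LocallyIntegrable f)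
    (hg : LocallyIntegrable g) (h : ∀ φ : 𝓢(ℝ, ℂ), ∫ x, φ x * f x = ∫ x, φ x * g x) :
    f =ᵐ[volume] g := by
  refine ae_eq_of_integral_contDiff_smul_eq hf hg fun χ hχ hχc ↦ ?_
  have h₁ : HasCompactSupport (Complex.ofRealCLM ∘ χ) := hχc.comp_left rfl
  have h₂ : ContDiff ℝ (⊤ : ℕ∞) (Complex.ofRealCLM ∘ χ) := by fun_prop
  simpa using h (h₁.toSchwartzMap h₂)

/-! ### The function `e^{-|x|}` in Bessel potential spaces -/

/-- `(1 - ∂ₓ²)^(s/2) e^{-|x|} = 2 G_{2-s}`, because the Fourier transform of `e^{-|x|}` is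
`2 (1 + (2πξ)²)⁻¹`. -/
theorem besselOp_exp_neg_abs_apply {u : 𝓢'(ℝ, ℂ)}
    (hu : IsGivenBy u fun x ↦ (Real.exp (-|x|) : ℂ)) {s : ℝ} (hs : s < 2) (φ : 𝓢(ℝ, ℂ)) :
    besselOp s u φ = ∫ x, φ x * ((2 * besselKernel (2 - s) x : ℝ) : ℂ) := by
  have e : (fun x : ℝ ↦ (Real.exp (-|x|) : ℂ)) = fun x ↦ (peakon 1 0 x : ℂ) := by
    ext x
    simp [peakon]
  rw [e] at hu
  rw [besselOp_apply_of_isGivenBy (f := fun x ↦ (peakon 1 0 x : ℂ))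
    (integrable_peakon 1 0).ofReal hu]
  have h := integral_besselKernel_mul_fourier (a := 2 - s) (by linarith) (𝓕⁻ φ)
  rw [FourierTransform.fourier_fourierInv_eq] at h
  calc _ = ∫ ξ : ℝ, 2 * ((((1 + (2 * π * ξ) ^ 2) ^ (-(2 - s) / 2) : ℝ) : ℂ) * 𝓕⁻ φ ξ) := by
        congr 1
        ext ξ
        rw [fourier_peakon, show -(2 - s) / 2 = -1 + s / 2 by ring, Real.rpow_add (by positivity)]
        push_cast
        simp
        ring
    _ = _ := by
        rw [integral_const_mul, ← h, ← integral_const_mul]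
        congr 1
        ext x
        push_cast
        ring

theorem memBesselSpace_exp_neg_abs_iff {s : ℝ} {p : ℝ≥0∞} [Fact (1 ≤ p)] (hs : s < 2) :
    MemBesselSpace (fun x ↦ (Real.exp (-|x|) : ℂ)) s p ↔ MemLp (besselKernel (2 - s)) p := by
  have hker : Integrable fun x ↦ ((2 * besselKernel (2 - s) x : ℝ) : ℂ) :=
    ((integrable_besselKernel (by linarith)).const_mul 2).ofReal
  constructor
  · -- The `L^p` function that represents `besselOp s u` is `2 G_{2-s}` almost everywhere.
    rintro ⟨u, hu, huf⟩
    obtain ⟨g, hg⟩ := mem_besselSpace_iff.1 hu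
    have hae := ae_eq_of_integral_schwartz_mul_eq
      ((Lp.memLp g).locallyIntegrable Fact.out) hker.locallyIntegrable fun φ ↦ by
        rw [← besselOp_exp_neg_abs_apply huf hs, hg]
        simp
    have h := ((memLp_congr_ae hae).1 (Lp.memLp g)).re.const_mul (1 / 2)
    simpa using! h
  · intro h
    have hf : Integrable fun x : ℝ ↦ (Real.exp (-|x|) : ℂ) := by
      simpa [peakon] using (integrable_peakon 1 0).ofReal (𝕜 := ℂ)
    have hu : IsGivenBy (Lp.toTemperedDistribution (memLp_one_iff_integrable.2 hf).toLp)
        fun x ↦ (Real.exp (-|x|) : ℂ) := fun φ ↦ by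
      obtain ⟨C, hC⟩ : ∃ C, ∀ x, ‖φ x‖ ≤ C := ⟨_, fun x ↦ SchwartzMap.norm_le_seminorm ℂ φ x⟩
      refine ⟨hf.bdd_mul (by have := φ.continuous; fun_prop) (.of_forall hC), ?_⟩
      rw [Lp.toTemperedDistribution_apply]
      refine integral_congr_ae ?_
      filter_upwards [(memLp_one_iff_integrable.2 hf).coeFn_toLp] with x hx
      rw [hx, smul_eq_mul]
    have hg : MemLp (fun x ↦ ((2 * besselKernel (2 - s) x : ℝ) : ℂ)) p := (h.const_mul 2).ofReal
    refine ⟨_, mem_besselSpace_iff.2 ⟨hg.toLp, ?_⟩, hu⟩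
    ext φ
    rw [besselOp_exp_neg_abs_apply hu hs, Lp.toTemperedDistribution_apply]
    refine integral_congr_ae ?_
    filter_upwards [hg.coeFn_toLp] with x hx
    rw [hx, smul_eq_mul]

/-! ### Peakons are not in `H^s` for `s ≥ 3/2` -/

theorem not_integrable_one_add_sq_rpow_neg_half :
    ¬ Integrable fun ξ : ℝ ↦ (1 + (2 * π * ξ) ^ 2) ^ (-1 / 2 : ℝ) := by
  intro h
  -- For `ξ > 1`, `1 + (2πξ)² ≤ (8ξ)²`, so that the integrand is at least `(8ξ)⁻¹`.
  have h1 : IntegrableOn (fun ξ : ℝ ↦ ξ ^ (-1 : ℝ)) (Set.Ioi 1) := by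
    refine (h.integrableOn.const_mul 8).mono' (by fun_prop)
      ((ae_restrict_mem measurableSet_Ioi).mono fun ξ hξ ↦ ?_)
    have hξ : 1 < ξ := hξ
    have hξ0 : 0 < ξ := by linarith
    have hle : 1 + (2 * π * ξ) ^ 2 ≤ (8 * ξ) ^ 2 := by
      have : (2 * π * ξ) ^ 2 ≤ (7 * ξ) ^ 2 := by
        gcongr
        linarith [Real.pi_lt_d2]
      nlinarith
    have := Real.rpow_le_rpow_of_nonpos (z := -1 / 2) (by positivity) hle (by norm_num)
    rw [← Real.rpow_natCast, ← Real.rpow_mul (by positivity)] at this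
    norm_num [Real.rpow_neg_one] at this
    rw [Real.norm_of_nonneg (by positivity), Real.rpow_neg_one]
    norm_num
    linarith
  rw [integrableOn_Ioi_rpow_iff zero_lt_one] at h1
  exact lt_irrefl _ h1

/-- By Plancherel, membership in `H^s` is square integrability of the Fourier transform times
`(1 + (2πξ)²)^(s/2)`, here of size at least `(1 + (2πξ)²)^(-1/4)`. -/
theorem not_memSobolevTwo_peakon {c s : ℝ} (t : ℝ) (hc : 0 < c) (hs : 3 / 2 ≤ s) :
    ¬ MemSobolevTwo (fun x ↦ (peakon c t x : ℂ)) s := by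
  rintro ⟨u, hu, huf⟩
  obtain ⟨g, hg⟩ := mem_besselSpace_iff.1 hu
  have hint : Integrable fun x ↦ (peakon c t x : ℂ) := (integrable_peakon c t).ofReal
  set F : ℝ → ℂ := fun ξ ↦ 𝓕 (fun x ↦ (peakon c t x : ℂ)) ξ *
    (((1 + (2 * π * ξ) ^ 2) ^ (s / 2) : ℝ) : ℂ) with hF
  have hFc : Continuous F := by
    simp_rw [hF, fourier_peakon]
    have h0 : ∀ ξ : ℝ, 1 + (2 * π * ξ) ^ 2 ≠ 0 := fun ξ ↦ by positivity
    have : ∀ r : ℝ, Continuous fun ξ : ℝ ↦ (1 + (2 * π * ξ) ^ 2) ^ r := fun r ↦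
      Continuous.rpow_const (by fun_prop) fun ξ ↦ .inl (h0 ξ)
    fun_prop
  have hae : ((𝓕 g : Lp ℂ 2 (volume : Measure ℝ)) : ℝ → ℂ) =ᵐ[volume] F :=
    ae_eq_of_integral_schwartz_mul_eq ((Lp.memLp _).locallyIntegrable one_le_two)
      hFc.locallyIntegrable fun φ ↦ by
        have h1 := besselOp_apply_of_isGivenBy hint huf s (𝓕 φ)
        rw [FourierTransform.fourierInv_fourier_eq, hg, ← TemperedDistribution.fourier_apply,
          Lp.fourier_toTemperedDistribution_eq, Lp.toTemperedDistribution_apply] at h1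
        simp_rw [smul_eq_mul] at h1
        rw [h1]
        congr 1
        ext ξ
        rw [hF]
        ring
  have hF2 : MemLp F 2 := (memLp_congr_ae hae).1 (Lp.memLp _)
  have hsq := (memLp_two_iff_integrable_sq_norm hF2.1).1 hF2
  refine not_integrable_one_add_sq_rpow_neg_half ((hsq.const_mul ((2 * c) ^ 2)⁻¹).mono'
    (Measurable.aestronglyMeasurable (by fun_prop)) (.of_forall fun ξ ↦ ?_))
  have hr : 1 ≤ 1 + (2 * π * ξ) ^ 2 := by linarith [sq_nonneg (2 * π * ξ)]
  have hr0 : 0 < 1 + (2 * π * ξ) ^ 2 := by positivity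
  have hnorm : ‖F ξ‖ = 2 * c * (1 + (2 * π * ξ) ^ 2) ^ (-1 + s / 2) := by
    rw [hF]
    simp only
    rw [fourier_peakon, norm_mul, norm_mul, norm_mul, Complex.norm_exp_ofReal_mul_I,
      Complex.norm_real, Complex.norm_real, Complex.norm_real, Real.norm_of_nonneg hc.le,
      Real.norm_of_nonneg (by positivity), Real.norm_of_nonneg (by positivity),
      Real.rpow_add hr0]
    ring
  rw [hnorm, mul_pow (2 * c), inv_mul_cancel_left₀ (by positivity), Real.norm_of_nonneg (by positivity),
    ← Real.rpow_mul_natCast hr0.le]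
  refine Real.rpow_le_rpow_of_exponent_le hr ?_
  push_cast
  linarith

theorem corollary2p11 :
    (∀ (p : ℝ) [Fact (1 ≤ ENNReal.ofReal p)], 1 < p →
      (∀ s : ℝ, 0 < s → s < 1 + 1 / p →
        MemBesselSpace (fun x : ℝ ↦ (Real.exp (-|x|) : ℂ)) s (ENNReal.ofReal p)) ∧
      ¬ MemBesselSpace (fun x : ℝ ↦ (Real.exp (-|x|) : ℂ)) (1 + 1 / p) (ENNReal.ofReal p)) ∧
    (∀ c t s : ℝ, 0 < c → 3 / 2 ≤ s →
      ¬ MemSobolevTwo (fun x : ℝ ↦ (peakon c t x : ℂ)) s) := by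
  refine ⟨fun p _ hp ↦ ?_, fun c t s hc hs ↦ not_memSobolevTwo_peakon t hc hs⟩
  have hp1 : 1 / p < 1 := (div_lt_one (by linarith)).2 hp
  refine ⟨fun s _ hs ↦ ?_, fun h ↦ ?_⟩
  · exact (memBesselSpace_exp_neg_abs_iff (by linarith)).2
      (memLp_besselKernel (by linarith) hp.le (by linarith))
  · rw [memBesselSpace_exp_neg_abs_iff (by linarith),
      show 2 - (1 + 1 / p) = 1 - 1 / p by ring] at h
    exact not_memLp_besselKernel hp h
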